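/- Let $X$ be a Banach space over $\mathbb{K}=\mathbb{R}$ or $\mathbb{C}$. An operator $A:X\to X$ is called weakly coercive if $\|A(u)\|\to\infty$ if and only if $\|u\|\to\infty$; that is, for every sequence $(u_n)$ in $X$, $\|A(u_n)\|\to\infty$ if and only if $\|u_n\|\to\infty$. An operator $A:X\to X$, not necessarily linear, is called compact if it is continuous and maps every bounded subset of $X$ to a relatively compact set. Let $f:X\to X$, $f=I+K+C$, be weakly coercive, where $I$ is the identity operator; $K:X\to X$ is linear and $k$-contractive for some $k\in[0,1)$, i.e. $\|Kx-Ky\|\le k\|x-y\|$ for all $x,y\in X$; $C:X\to X$ is a compact operator of class $C^1$ (in the sense of Fréchet derivatives over $\mathbb{K}$); and, for every $x\in X$, the linear operator $I+K+C'(x):X\to X$ is weakly coercive. Then: (a) $f$ is a global $C^1$-diffeomorphism of $X$ onto $X$, i.e. $f$ is bijective and both $f$ and $f^{-1}$ are of class $C^1$; (b) the operator $-K-C$ has a unique fixed point in $X$. -/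

import Mathlib

open Filter Function
open scoped NNReal Manifold

/-- An operator `A : X → Y` is weakly coercive if `‖A u‖ → ∞` if and only if `‖u‖ → ∞`,
i.e. along every sequence one of the two norms tends to infinity exactly when the other does. -/
def WeaklyCoercive {X Y : Type*} [Norm X] [Norm Y] (A : X → Y) : Prop :=
  ∀ u : ℕ → X, Tendsto (fun n => ‖A (u n)‖) atTop atTop ↔ Tendsto (fun n => ‖u n‖) atTop atTop

/-- A (not necessarily linear) operator is compact if it is continuous and maps bounded sets to
relatively compact sets. (Mathlib's `IsCompactOperator` is meant for linear operators: it only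
looks at one neighbourhood of zero.) -/
structure IsCompactMap {X Y : Type*} [TopologicalSpace X] [Bornology X] [TopologicalSpace Y]
    (A : X → Y) : Prop where
  continuous : Continuous A
  isCompact_closure_image : ∀ B : Set X, Bornology.IsBounded B → IsCompact (closure (A '' B))

/-! `f` is a proper local diffeomorphism, hence a covering of the simply connected space `X`, hence
bijective. Put `L = I + K`, invertible by a Neumann series. Each `C'(x)` is compact, so by the
Fredholm alternative `L + C'(x)` is invertible once injective, and weak coercivity gives
injectivity; the inverse function theorem then applies. Properness comes from `x = L⁻¹(f x - C x)`,
where `C x` stays in a compact set as long as `f x` is bounded. Fixed points of `-K - C` are the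
zeros of `f`. -/

open Metric Set in
/-- A set that is approximated to any accuracy by totally bounded sets is totally bounded. -/
theorem Metric.totallyBounded_of_forall_approx {E : Type*} [PseudoMetricSpace E] {A : Set E}
    (h : ∀ ε > 0, ∃ S : Set E, TotallyBounded S ∧ ∀ a ∈ A, ∃ s ∈ S, dist a s ≤ ε) :
    TotallyBounded A := by
  refine Metric.totallyBounded_iff.2 fun ε hε => ?_
  obtain ⟨S, hS, hAS⟩ := h (ε / 2) (half_pos hε)
  obtain ⟨t, ht, hSt⟩ := Metric.totallyBounded_iff.1 hS (ε / 2) (half_pos hε)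
  refine ⟨t, ht, fun a ha => ?_⟩
  obtain ⟨s, hs, has⟩ := hAS a ha
  obtain ⟨y, hy, hsy⟩ := mem_iUnion₂.1 (hSt hs)
  refine mem_iUnion₂.2 ⟨y, hy, ?_⟩
  rw [mem_ball] at hsy ⊢
  linarith [dist_triangle a s y]

open Metric Set in
/-- The Fréchet derivative of a compact map is a compact linear operator. -/
theorem IsCompactMap.isCompactOperator_of_hasFDerivAt {𝕜 : Type*} [RCLike 𝕜]
    {X Y : Type*} [NormedAddCommGroup X] [NormedSpace 𝕜 X]
    [NormedAddCommGroup Y] [NormedSpace 𝕜 Y] [CompleteSpace Y]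
    {C : X → Y} (hC : IsCompactMap C) {D : X →L[𝕜] Y} {x : X} (hD : HasFDerivAt C D x) :
    IsCompactOperator D := by
  refine (isCompactOperator_iff_isCompact_closure_image_closedBall D.toLinearMap one_pos).2 ?_
  refine TotallyBounded.isCompact_of_isClosed ?_ isClosed_closure
  refine TotallyBounded.closure (Metric.totallyBounded_of_forall_approx fun ε hε => ?_)
  obtain ⟨δ, hδ, hδD⟩ :=
    Metric.eventually_nhds_iff.1 ((hasFDerivAt_iff_isLittleO_nhds_zero.1 hD).def hε)
  obtain ⟨r, hr0, hrδ⟩ := exists_between hδ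
  -- Difference quotients of `C` at the single scale `r` approximate `D v` within `ε`, uniformly on
  -- the unit ball.
  refine ⟨(fun y => (r : 𝕜)⁻¹ • (y - C x)) '' closure (C '' closedBall x r), ?_, ?_⟩
  · exact ((hC.isCompact_closure_image _ isBounded_closedBall).image
      (by fun_prop)).totallyBounded
  · rintro _ ⟨v, hv, rfl⟩
    have hv1 : ‖v‖ ≤ 1 := by simpa using hv
    have hr : ‖(r : 𝕜)‖ = r := by simp [abs_of_pos hr0]
    have hr' : (r : 𝕜) ≠ 0 := by simpa using hr0.ne'
    have hrv : ‖(r : 𝕜) • v‖ ≤ r := by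
      rw [norm_smul, hr]; exact mul_le_of_le_one_right hr0.le hv1
    refine ⟨_, mem_image_of_mem _ (subset_closure
      (mem_image_of_mem C (show x + (r : 𝕜) • v ∈ closedBall x r by simpa using hrv))), ?_⟩
    have hlin : (r : 𝕜)⁻¹ • (C (x + (r : 𝕜) • v) - C x) - D v
        = (r : 𝕜)⁻¹ • (C (x + (r : 𝕜) • v) - C x - D ((r : 𝕜) • v)) := by
      rw [smul_sub _ _ (D _), map_smul, inv_smul_smul₀ hr']
    have hb := hδD (y := (r : 𝕜) • v) (by simpa using hrv.trans_lt hrδ)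
    change dist (D v) _ ≤ ε
    rw [dist_comm, dist_eq_norm, hlin, norm_smul, norm_inv, hr, inv_mul_le_iff₀ hr0, mul_comm]
    exact hb.trans (mul_le_mul_of_nonneg_left hrv hε.le)

/-- Preimages of bounded sets under a weakly coercive map are bounded. -/
theorem WeaklyCoercive.isBounded_preimage {X Y : Type*} [SeminormedAddCommGroup X]
    [SeminormedAddCommGroup Y] {f : X → Y} (hf : WeaklyCoercive f) {S : Set Y}
    (hS : Bornology.IsBounded S) : Bornology.IsBounded (f ⁻¹' S) := by
  by_contra h
  obtain ⟨R, hR⟩ := hS.exists_norm_le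
  have hu : ∀ n : ℕ, ∃ u ∈ f ⁻¹' S, (n : ℝ) < ‖u‖ := by
    intro n
    by_contra! hn
    exact h (isBounded_iff_forall_norm_le.2 ⟨n, hn⟩)
  choose u huS hun using hu
  have h1 : Tendsto (fun n => ‖u n‖) atTop atTop :=
    tendsto_atTop_mono (fun n => (hun n).le) tendsto_natCast_atTop_atTop
  obtain ⟨n, hn⟩ := (((hf u).2 h1).eventually_gt_atTop R).exists
  exact (hR _ (huS n)).not_gt hn

/-- A weakly coercive linear map has trivial kernel. -/
theorem WeaklyCoercive.eq_zero_of_map_eq_zero {𝕜 X Y : Type*} [RCLike 𝕜]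
    [NormedAddCommGroup X] [NormedSpace 𝕜 X] [NormedAddCommGroup Y] [NormedSpace 𝕜 Y]
    {A : X →L[𝕜] Y} (hA : WeaklyCoercive A) {v : X} (hv : A v = 0) : v = 0 := by
  by_contra h0
  have h1 : Tendsto (fun n : ℕ => ‖(n : 𝕜) • v‖) atTop atTop := by
    simp only [norm_smul, RCLike.norm_natCast]
    exact tendsto_natCast_atTop_atTop.atTop_mul_const (norm_pos_iff.2 h0)
  have h2 := (hA fun n : ℕ => (n : 𝕜) • v).2 h1
  simp only [map_smul, hv, smul_zero, norm_zero] at h2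
  exact not_tendsto_const_atTop _ _ h2

/-- If `K` is a linear contraction of a Banach space, then `I + K` is an isomorphism. -/
theorem ContractingWith.exists_continuousLinearEquiv_add {𝕜 X : Type*} [RCLike 𝕜]
    [NormedAddCommGroup X] [NormedSpace 𝕜 X] [CompleteSpace X] {k : ℝ≥0} {K : X →ₗ[𝕜] X}
    (hK : ContractingWith k K) : ∃ L : X ≃L[𝕜] X, ∀ x, L x = x + K x := by
  let T : X →L[𝕜] X := ⟨K, hK.2.continuous⟩
  have hT : ‖-T‖ < 1 := by
    rw [norm_neg]
    refine lt_of_le_of_lt (T.opNorm_le_bound k.2 fun x => ?_) (NNReal.coe_lt_one.2 hK.1)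
    simpa [T] using hK.2.dist_le_mul x 0
  refine ⟨ContinuousLinearEquiv.ofUnit (Units.oneSub (-T) hT), fun x => ?_⟩
  change (1 - -T) x = _
  simp [T]

/-- A compact perturbation of an isomorphism is an isomorphism as soon as it is injective. -/
theorem IsCompactOperator.exists_continuousLinearEquiv_add {𝕜 X Y : Type*} [RCLike 𝕜]
    [NormedAddCommGroup X] [NormedSpace 𝕜 X] [CompleteSpace X]
    [NormedAddCommGroup Y] [NormedSpace 𝕜 Y]
    (L : X ≃L[𝕜] Y) {D : X →L[𝕜] Y} (hD : IsCompactOperator D)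
    (hinj : ∀ v, L v + D v = 0 → v = 0) :
    ∃ A : X ≃L[𝕜] Y, (A : X →L[𝕜] Y) = L + D := by
  -- `L + D = L (1 - T)`, so only the eigenvalue `1` of the compact operator `T` has to be excluded.
  let T : X →L[𝕜] X := -((L.symm : Y →L[𝕜] X) ∘L D)
  have hT : IsCompactOperator T := (hD.clm_comp (L.symm : Y →L[𝕜] X)).neg
  have hne : ¬ Module.End.HasEigenvalue (T : Module.End 𝕜 X) 1 := by
    intro h
    obtain ⟨v, hv⟩ := h.exists_hasEigenvector
    refine hv.2 (hinj v ?_)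
    have h1 : -L.symm (D v) = v := by simpa [T] using hv.apply_eq_smul
    have h2 : -D v = L v := by rw [← congrArg L h1]; simp
    rw [← h2, neg_add_cancel]
  obtain ⟨U, hU⟩ : IsUnit (algebraMap 𝕜 (X →L[𝕜] X) 1 - T) :=
    (hT.hasEigenvalue_or_mem_resolventSet one_ne_zero).resolve_left hne
  refine ⟨(ContinuousLinearEquiv.ofUnit U).trans L, ?_⟩
  ext v
  change L ((U : X →L[𝕜] X) v) = L v + D v
  rw [hU]
  simp [T]

/-- A proper local homeomorphism between Hausdorff spaces is a covering map. -/
theorem IsProperMap.isCoveringMap_of_isLocalHomeomorph {E B : Type*} [TopologicalSpace E]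
    [TopologicalSpace B] [T2Space E] [T1Space B] {f : E → B} (hf : IsProperMap f)
    (h : IsLocalHomeomorph f) : IsCoveringMap f := by
  rw [isCoveringMap_iff_isCoveringMapOn_univ]
  refine hf.isClosedMap.isCoveringMapOn_of_isLocalHomeomorphOn (fun x _ => ?_) ?_
  -- Fibres are compact and discrete, hence finite.
  · exact (hf.isCompact_preimage isCompact_singleton).finite
      (.of_openPartialHomeomorph f subset_rfl fun e _ =>
        let ⟨φ, he, hφ⟩ := h e; ⟨φ, he, hφ.symm⟩)
  · simpa [← isLocalHomeomorph_iff_isLocalHomeomorphOn_univ] using h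

/-- A covering map from a connected space to a simply connected, locally path-connected space
is injective. -/
theorem IsCoveringMap.injective_of_simplyConnectedSpace {E B : Type*} [TopologicalSpace E]
    [TopologicalSpace B] [PreconnectedSpace E] [SimplyConnectedSpace B]
    [LocallyPathConnectedSpace B] {f : E → B} (hf : IsCoveringMap f) : Function.Injective f := by
  intro x y hxy
  obtain ⟨s, ⟨hsx, hs⟩, -⟩ :=
    hf.existsUnique_continuousMap_lifts (ContinuousMap.id B) (f x) x rfl
  -- Both `s ∘ f` and `id` lift `f` and agree at `x`; lifts from a connected space are unique.
  have hsf : s ∘ f = id := hf.eq_of_comp_eq (s.continuous.comp hf.continuous) continuous_id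
    (by rw [← Function.comp_assoc, hs]; rfl) x hsx
  calc x = s (f x) := hsx.symm
    _ = s (f y) := by rw [hxy]
    _ = y := congrFun hsf y

/-- **Hadamard's theorem**: a proper local homeomorphism from a nonempty connected space to a simply
connected, locally path-connected Hausdorff space is bijective. -/
theorem IsProperMap.bijective_of_isLocalHomeomorph {E B : Type*} [TopologicalSpace E]
    [TopologicalSpace B] [T2Space E] [T1Space B] [ConnectedSpace E] [SimplyConnectedSpace B]
    [LocallyPathConnectedSpace B] {f : E → B} (hf : IsProperMap f)
    (h : IsLocalHomeomorph f) : Function.Bijective f := by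
  refine ⟨(hf.isCoveringMap_of_isLocalHomeomorph h).injective_of_simplyConnectedSpace, ?_⟩
  exact Set.range_eq_univ.1
    (IsClopen.eq_univ ⟨hf.isClosed_range, h.isOpenMap.isOpen_range⟩ (Set.range_nonempty f))

/-- A weakly coercive compact perturbation of a homeomorphism is proper. -/
theorem WeaklyCoercive.isProperMap {X Y : Type*} [NormedAddCommGroup X] [NormedAddCommGroup Y]
    {L : X ≃ₜ Y} {C f : X → Y} (hf : WeaklyCoercive f)
    (hC : IsCompactMap C) (hfLC : ∀ x, f x = L x + C x) : IsProperMap f := by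
  have hcont : Continuous f := by
    rw [funext hfLC]; exact L.continuous.add hC.continuous
  refine isProperMap_iff_isCompact_preimage.2 ⟨hcont, fun S hS => ?_⟩
  have hcpt := hC.isCompact_closure_image _ (hf.isBounded_preimage hS.isBounded)
  -- `f ⁻¹' S` is a closed subset of the `L`-preimage of the compact set `S - closure (C '' (f ⁻¹'
  -- S))`.
  refine (L.isCompact_preimage.2 ((hS.prod hcpt).image continuous_sub)).of_isClosed_subset
    (hS.isClosed.preimage hcont) fun x hx => ?_
  exact ⟨(f x, C x), ⟨hx, subset_closure ⟨x, hx, rfl⟩⟩, by simp [hfLC]⟩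

/-- A proper `C^n` map between Banach spaces (`n ≥ 1`) whose derivative is everywhere invertible is
a global `C^n` diffeomorphism. -/
theorem IsProperMap.exists_diffeomorph {𝕜 : Type*} [RCLike 𝕜] {X Y : Type*}
    [NormedAddCommGroup X] [NormedSpace 𝕜 X] [CompleteSpace X]
    [NormedAddCommGroup Y] [NormedSpace 𝕜 Y] {n : WithTop ℕ∞} (hn : n ≠ 0)
    {f : X → Y} (hprop : IsProperMap f) (hf : ContDiff 𝕜 n f) {f' : X → X ≃L[𝕜] Y}
    (hf' : ∀ x, HasFDerivAt f (f' x : X →L[𝕜] Y) x) :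
    ∃ Φ : Diffeomorph 𝓘(𝕜, X) 𝓘(𝕜, Y) X Y n, ∀ x, Φ x = f x := by
  -- The real structure supplies the path-connectedness and contractibility used by Hadamard's
  -- theorem.
  let _ : NormedSpace ℝ X := NormedSpace.restrictScalars ℝ 𝕜 X
  let _ : NormedSpace ℝ Y := NormedSpace.restrictScalars ℝ 𝕜 Y
  have hloc : IsLocalHomeomorph f := fun x =>
    ⟨hf.contDiffAt.toOpenPartialHomeomorph f (hf' x) hn,
      hf.contDiffAt.mem_toOpenPartialHomeomorph_source (hf' x) hn, rfl⟩
  let e : X ≃ₜ Y := hloc.toHomeomorphOfBijective (hprop.bijective_of_isLocalHomeomorph hloc)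
  exact ⟨⟨e.toEquiv, hf.contMDiff, (e.contDiff_symm hf' hf).contMDiff⟩, fun _ => rfl⟩

theorem corollary2 {𝕜 : Type*} [RCLike 𝕜]
    {X : Type*} [NormedAddCommGroup X] [NormedSpace 𝕜 X] [CompleteSpace X]
    (k : ℝ≥0) (K : X →ₗ[𝕜] X) (hK : ContractingWith k K)
    (C : X → X) (hC1 : ContDiff 𝕜 1 C) (hC : IsCompactMap C)
    (f : X → X) (hf : ∀ x, f x = x + K x + C x) (hf_coercive : WeaklyCoercive f)
    (h_deriv : ∀ x, WeaklyCoercive (fun v => v + K v + fderiv 𝕜 C x v)) :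
    (∃ Φ : Diffeomorph 𝓘(𝕜, X) 𝓘(𝕜, X) X X 1, ∀ x, Φ x = f x) ∧
      (∃! x, IsFixedPt (fun y => -K y + -C y) x) := by
  obtain ⟨L, hL⟩ := hK.exists_continuousLinearEquiv_add
  have hfLC : ∀ x, f x = L x + C x := fun x => by rw [hf, hL]
  have hderiv : ∀ x, ∃ A : X ≃L[𝕜] X, (A : X →L[𝕜] X) = L + fderiv 𝕜 C x := fun x => by
    have hCx : HasFDerivAt C (fderiv 𝕜 C x) x :=
      (hC1.differentiable one_ne_zero x).hasFDerivAt
    have hcoe : WeaklyCoercive ((L : X →L[𝕜] X) + fderiv 𝕜 C x) := by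
      simpa only [← hL] using! h_deriv x
    exact (hC.isCompactOperator_of_hasFDerivAt hCx).exists_continuousLinearEquiv_add L
      fun v hv => hcoe.eq_zero_of_map_eq_zero hv
  choose f' hf' using hderiv
  have hfun : f = fun x => L x + C x := funext hfLC
  have hfC1 : ContDiff 𝕜 1 f := hfun ▸ L.contDiff.add hC1
  have hfd : ∀ x, HasFDerivAt f (f' x : X →L[𝕜] X) x := fun x => by
    rw [hf', hfun]
    exact L.hasFDerivAt.add (hC1.differentiable one_ne_zero x).hasFDerivAt
  have hprop : IsProperMap f := hf_coercive.isProperMap (L := L.toHomeomorph) hC hfLC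
  obtain ⟨Φ, hΦ⟩ := hprop.exists_diffeomorph one_ne_zero hfC1 hfd
  refine ⟨⟨Φ, hΦ⟩, ?_⟩
  have hfix : ∀ x, IsFixedPt (fun y => -K y + -C y) x ↔ Φ x = 0 := fun x => by
    rw [hΦ, hf, IsFixedPt, eq_comm, ← sub_eq_zero, sub_add_eq_sub_sub, sub_neg_eq_add,
      sub_neg_eq_add]
  simp only [hfix]
  exact Φ.bijective.existsUnique 0
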